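/- Let $g,h\in L^\infty(\mathbb R)$ be probability densities with finite first moments, let $0\le u\in L^\infty(\mathbb R\times\mathbb R)$, and let $\Pi(g,h;u)$ be the set of densities $f$ of couplings of $g\,dx$ and $h\,dy$ with $0\le f\le u$ Lebesgue-a.e.; assume that $\Pi(g,h;u)\neq\emptyset$. Let $c:\mathbb R\times\mathbb R\to(-\infty,\infty]$ be lower semicontinuous with $c(x,y)\ge -C(1+|x|+|y|)$ for some constant $C\ge 0$. Let $\Psi_c$ be the set of all triples $(\phi,\psi,\kappa)$ of real-valued functions with $\phi\in L^1(g\,dx)$, $\psi\in L^1(h\,dy)$, $\kappa\in L^1(u\,dx\,dy)$ and $$\phi(x)+\psi(y)\le c(x,y)+\kappa(x,y),\qquad \kappa(x,y)\ge 0\qquad\text{for all }x,y\in\mathbb R,$$ and put $$F(\phi,\psi,\kappa)=\int\phi g\,dx+\int\psi h\,dy-\int\kappa u\,dx\,dy .$$ Then strong duality holds (as an identity in $(-\infty,+\infty]$): $$\inf_{f\in\Pi(g,h;u)}\int c f\,dx\,dy=\sup_{(\phi,\psi,\kappa)\in\Psi_c}F(\phi,\psi,\kappa),$$ and the identity also holds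 if the inequalities defining $\Psi_c$ are required for Lebesgue-a.e. $(x,y)$ only. The infimum is attained. Moreover, the supremum over $\Psi_c$ does not change if $\phi,\psi,\kappa$ are restricted to be continuous with $\phi(x)+C|x|$, $\psi(y)+C|y|$ and $\kappa(x,y)$ bounded; and if $c$ is bounded below, it does not change if $\phi,\psi,\kappa$ are restricted to be continuous and bounded. -/

import Mathlib

open MeasureTheory

noncomputable section

/-- `Π(g, h; u)`: the functions `f` on `ℝ × ℝ` that are densities (with respect to Lebesgue measure)
of couplings of `g dx` and `h dy` and satisfy `0 ≤ f ≤ u` almost everywhere. -/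
structure IsCapacityCoupling (g h : ℝ → ℝ) (u f : ℝ × ℝ → ℝ) : Prop where
  integrable : Integrable f
  nonneg : ∀ᵐ p, 0 ≤ f p
  le_upper : ∀ᵐ p, f p ≤ u p
  marginal_fst : ∀ᵐ x, ∫ y, f (x, y) = g x
  marginal_snd : ∀ᵐ y, ∫ x, f (x, y) = h y

/-- The cost `P(f) = ∫ c f dλ` of a nonnegative density `f`, for a cost with values in the extended
reals: the integral of the positive part minus the integral of the negative part. When
`c ≥ -C (1 + |x| + |y|)` and `f` has finite first moments, the second integral is finite. -/
def primalCost (c : ℝ × ℝ → EReal) (f : ℝ × ℝ → ℝ) : EReal :=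
  ((∫⁻ p, (c p).toENNReal * ENNReal.ofReal (f p) : ENNReal) : EReal)
    - ((∫⁻ p, (-c p).toENNReal * ENNReal.ofReal (f p) : ENNReal) : EReal)

/-- The infimum of `P(f)` over `Π(g, h; u)`. -/
def primalValue (c : ℝ × ℝ → EReal) (g h : ℝ → ℝ) (u : ℝ × ℝ → ℝ) : EReal :=
  ⨅ (f : ℝ × ℝ → ℝ) (_ : IsCapacityCoupling g h u f), primalCost c f

/-- The dual objective `F(φ, ψ, κ) = ∫ φ g dx + ∫ ψ h dy - ∫ κ u dxdy`. -/
def dualObjective (g h : ℝ → ℝ) (u : ℝ × ℝ → ℝ) (t : (ℝ → ℝ) × (ℝ → ℝ) × (ℝ × ℝ → ℝ)) : ℝ :=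
  (∫ x, t.1 x * g x) + (∫ y, t.2.1 y * h y) - ∫ p, t.2.2 p * u p

/-- The supremum of the dual objective over a set of triples `(φ, ψ, κ)`. -/
def dualValue (g h : ℝ → ℝ) (u : ℝ × ℝ → ℝ)
    (S : Set ((ℝ → ℝ) × (ℝ → ℝ) × (ℝ × ℝ → ℝ))) : EReal :=
  ⨆ t ∈ S, (dualObjective g h u t : EReal)

/-- The triples `(φ, ψ, κ)` with `φ ∈ L¹(g dx)`, `ψ ∈ L¹(h dy)` and `κ ∈ L¹(u dxdy)`. -/
def integrableTriples (g h : ℝ → ℝ) (u : ℝ × ℝ → ℝ) :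
    Set ((ℝ → ℝ) × (ℝ → ℝ) × (ℝ × ℝ → ℝ)) :=
  {t | Integrable (fun x => t.1 x * g x) ∧ Integrable (fun y => t.2.1 y * h y) ∧
    Integrable (fun p => t.2.2 p * u p)}

/-- `Ψ_c`: integrable triples with `φ(x) + ψ(y) ≤ c(x, y) + κ(x, y)` and `κ(x, y) ≥ 0`
for all `x` and `y`. -/
def dualSet (c : ℝ × ℝ → EReal) (g h : ℝ → ℝ) (u : ℝ × ℝ → ℝ) :
    Set ((ℝ → ℝ) × (ℝ → ℝ) × (ℝ × ℝ → ℝ)) :=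
  {t ∈ integrableTriples g h u |
    ∀ x y, ((t.1 x + t.2.1 y : ℝ) : EReal) ≤ c (x, y) + (t.2.2 (x, y) : EReal) ∧ 0 ≤ t.2.2 (x, y)}

/-- The variant of `Ψ_c` in which the inequalities are required for Lebesgue-almost every `(x, y)`
only. -/
def dualSetAE (c : ℝ × ℝ → EReal) (g h : ℝ → ℝ) (u : ℝ × ℝ → ℝ) :
    Set ((ℝ → ℝ) × (ℝ → ℝ) × (ℝ × ℝ → ℝ)) :=
  {t ∈ integrableTriples g h u |
    ∀ᵐ p : ℝ × ℝ, ((t.1 p.1 + t.2.1 p.2 : ℝ) : EReal) ≤ c p + (t.2.2 p : EReal) ∧ 0 ≤ t.2.2 p}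

/-- Triples `(φ, ψ, κ)` of continuous functions such that `φ(x) + B|x|`, `ψ(y) + B|y|` and `κ(x, y)`
are bounded. For `B = 0` these are the triples of continuous bounded functions. -/
def continuousTriples (B : ℝ) : Set ((ℝ → ℝ) × (ℝ → ℝ) × (ℝ × ℝ → ℝ)) :=
  {t | Continuous t.1 ∧ Continuous t.2.1 ∧ Continuous t.2.2 ∧
    (∃ M : ℝ, ∀ x, |t.1 x + (B * |x|)| ≤ M) ∧ (∃ M : ℝ, ∀ y, |t.2.1 y + (B * |y|)| ≤ M) ∧
    ∃ M : ℝ, ∀ p, |t.2.2 p| ≤ M}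

end

/-! Adding `C|x| + K + C|y|` to the cost changes the primal cost of every coupling and the dual
value of every shifted triple by one and the same constant, because this function is a sum of
functions of one variable and the marginals are fixed. So the cost may be taken nonnegative.

For `c ≥ 0`, suppose that the dual objective is at most `α` on bounded continuous triples. Given
bounded continuous `φ`, `ψ` and a compactly supported `ζ` with `φ + ψ + ζ ≤ c`, the choice `κ = ζ⁻`
turns this into the bound `∫ φg + ∫ ψh - ∫ ζ⁻u ≤ α`, whose left side is the minimum of `∫ ζf + ∫ φg
+ ∫ ψh` over `0 ≤ f ≤ u`. These `f` form a weakly compact convex set, so Sion's theorem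
(`exists_forall_apply_add_le`) yields one `f` that works for all such `(φ, ψ, ζ)`.

That `f` is optimal (`exists_coupling_of_forall_dual_le`). Triples with `φ + ψ + ζ ≤ 0` form a cone,
and scaling them forces the marginals. Triples with `φ = ψ = 0` and `ζ ↑ c` give the cost bound by
monotone convergence. Taking `α` to be the dual supremum gives attainment and the hard inequality.
Weak duality, valid even for almost everywhere constraints, closes the circle for all versions of
the dual at once. -/

/-! ### Minimax on a weak-* compact set -/

open Topology Set in
-- If every `T` is violated by some `y`, compactness of `U` leaves finitely many violating `y`, and
-- Sion's theorem replaces them by a single `y ∈ Y` violating all `T` at once. No compactness of `Y`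
-- is needed.
theorem exists_forall_apply_add_le {H : Type*} [NormedAddCommGroup H] [NormedSpace ℝ H]
    {U : Set (WeakDual ℝ H)} (hU : IsCompact U) (hUc : Convex ℝ U) (hUn : U.Nonempty)
    {Y : Set (H × ℝ)} (hY : Convex ℝ Y) {α : ℝ}
    (h : ∀ y ∈ Y, ∃ T ∈ U, T y.1 + y.2 ≤ α) :
    ∃ T ∈ U, ∀ y ∈ Y, T y.1 + y.2 ≤ α := by
  by_contra! hcon
  have hfy : ∀ y ∈ Y, LowerSemicontinuousOn (fun T : WeakDual ℝ H => T y.1 + y.2) U := by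
    intro y _
    exact ((WeakDual.eval_continuous y.1).add continuous_const).lowerSemicontinuous.lowerSemicontinuousOn _
  have hfin : ∃ s : Finset Y, ∀ T ∈ U, ∃ i ∈ s, α < T i.1.1 + i.1.2 := by
    rw [← LowerSemicontinuousOn.inter_biInter_preimage_Iic_eq_empty_iff_exists_finset hU hfy]
    apply Set.eq_empty_of_forall_notMem
    rintro T ⟨hT, hT'⟩
    obtain ⟨y, hy, hlt⟩ := hcon T hT
    simp only [mem_iInter, mem_preimage, mem_Iic] at hT'
    exact absurd (hT' y hy) (not_le.2 hlt)
  obtain ⟨s, hs⟩ := hfin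
  have hquasi : ∀ y ∈ Y, QuasiconvexOn ℝ U (fun T : WeakDual ℝ H => T y.1 + y.2) := by
    intro y _
    refine ConvexOn.quasiconvexOn ⟨hUc, ?_⟩
    intro S _ T _ a b _ _ hab
    have hS : (a • S + b • T) y.1 = a * S y.1 + b * T y.1 := rfl
    simp only [hS, smul_eq_mul]
    have : y.2 = (a + b) * y.2 := by rw [hab, one_mul]
    linarith
  have hquasi' : ∀ T ∈ U, QuasiconcaveOn ℝ Y (fun y : H × ℝ => T y.1 + y.2) := by
    intro T _
    refine ConcaveOn.quasiconcaveOn ⟨hY, ?_⟩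
    intro x _ y _ a b _ _ _
    simp only [Prod.fst_add, Prod.smul_fst, map_add, map_smul, Prod.snd_add, Prod.smul_snd,
      smul_eq_mul]
    linarith
  have husc : ∀ T ∈ U, UpperSemicontinuousOn (fun y : H × ℝ => T y.1 + y.2) Y := by
    intro T _
    have : Continuous (fun y : H × ℝ => T y.1 + y.2) :=
      ((WeakDual.toStrongDual T).continuous.comp continuous_fst).add continuous_snd
    exact this.upperSemicontinuous.upperSemicontinuousOn _
  obtain ⟨y, hy, hlt⟩ := Sion.exists_lt_iInf_of_lt_iInf_of_finite (X := U) (Y := Y)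
    (f := fun T y => T y.1 + y.2) hUn hU hfy hquasi hY husc hquasi' hUc
    (s := Subtype.val '' (s : Set Y)) (toFinite _) (Subtype.coe_image_subset Y ↑s) (t := α)
    (fun T hT => by
      obtain ⟨i, hi, hlt⟩ := hs T hT
      exact ⟨i.1, ⟨i, hi, rfl⟩, hlt⟩)
  obtain ⟨T, hT, hle⟩ := h y hy
  exact absurd hle (not_le.2 (hlt T hT))

/-! ### Order intervals of `L²` as weak-* compact sets -/

/-- The order interval `[0, V]` of `L²`, as a set of functionals. -/
def orderIntervalDual {Ω : Type*} [MeasurableSpace Ω] {μ : Measure Ω} (V : Lp ℝ 2 μ) :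
    Set (WeakDual ℝ (Lp ℝ 2 μ)) :=
  {T | ∀ ξ : Lp ℝ 2 μ, 0 ≤ ξ → 0 ≤ T ξ ∧ T ξ ≤ inner ℝ V ξ}

section OrderInterval

variable {Ω : Type*} [MeasurableSpace Ω] {μ : Measure Ω}

theorem convex_orderIntervalDual (V : Lp ℝ 2 μ) : Convex ℝ (orderIntervalDual V) := by
  intro S hS T hT a b ha hb hab ξ hξ
  obtain ⟨h1, h2⟩ := hS ξ hξ
  obtain ⟨h3, h4⟩ := hT ξ hξ
  have hST : (a • S + b • T) ξ = a * S ξ + b * T ξ := rfl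
  rw [hST]
  refine ⟨by positivity, ?_⟩
  calc a * S ξ + b * T ξ ≤ a * inner ℝ V ξ + b * inner ℝ V ξ := by gcongr
    _ = inner ℝ V ξ := by rw [← add_mul, hab, one_mul]

/-- Banach–Alaoglu: the set is weak-* closed, and it lies in the ball of radius `‖V‖` since `T ξ ≤ T
|ξ| ≤ ⟪V, |ξ|⟫ ≤ ‖V‖ ‖ξ‖`. -/
theorem isCompact_orderIntervalDual (V : Lp ℝ 2 μ) : IsCompact (orderIntervalDual V) := by
  have hcl : IsClosed (orderIntervalDual V) := by
    have : orderIntervalDual V = ⋂ ξ : Lp ℝ 2 μ, ⋂ _ : 0 ≤ ξ,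
        {T : WeakDual ℝ (Lp ℝ 2 μ) | 0 ≤ T ξ ∧ T ξ ≤ inner ℝ V ξ} := by
      ext T; simp [orderIntervalDual]
    rw [this]
    refine isClosed_iInter fun ξ => isClosed_iInter fun _ => ?_
    exact (isClosed_le continuous_const (WeakDual.eval_continuous ξ)).inter
      (isClosed_le (WeakDual.eval_continuous ξ) continuous_const)
  refine (WeakDual.isCompact_closedBall (0 : StrongDual ℝ (Lp ℝ 2 μ)) ‖V‖).of_isClosed_subset
    hcl ?_
  intro T hT
  simp only [Set.mem_preimage, mem_closedBall_zero_iff]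
  have key : ∀ ξ : Lp ℝ 2 μ, T ξ ≤ ‖V‖ * ‖ξ‖ := by
    intro ξ
    have h1 : 0 ≤ T (|ξ| - ξ) := (hT _ (sub_nonneg.2 (le_abs_self ξ))).1
    rw [map_sub] at h1
    have h2 := (hT |ξ| (abs_nonneg ξ)).2
    have h3 := real_inner_le_norm V |ξ|
    rw [norm_abs_eq_norm] at h3
    linarith
  refine ContinuousLinearMap.opNorm_le_bound _ (norm_nonneg _) fun ξ => ?_
  change |T ξ| ≤ _
  refine abs_le.2 ⟨?_, key ξ⟩
  have := key (-ξ)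
  rw [map_neg, norm_neg] at this
  linarith

theorem inner_Lp_eq_integral (F ξ : Lp ℝ 2 μ) : inner ℝ F ξ = ∫ x, F x * ξ x ∂μ := by
  rw [L2.inner_def]
  refine integral_congr_ae (.of_forall fun x => ?_)
  simp [mul_comm]

theorem toDual_mem_orderIntervalDual {V F : Lp ℝ 2 μ} (h0 : 0 ≤ F) (h1 : F ≤ V) :
    StrongDual.toWeakDual (InnerProductSpace.toDual ℝ (Lp ℝ 2 μ) F) ∈ orderIntervalDual V := by
  intro ξ hξ
  have hnn : ∀ G : Lp ℝ 2 μ, 0 ≤ G → 0 ≤ (inner ℝ G ξ : ℝ) := by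
    intro G hG
    rw [inner_Lp_eq_integral]
    refine integral_nonneg_of_ae ?_
    filter_upwards [(Lp.coeFn_nonneg G).2 hG, (Lp.coeFn_nonneg ξ).2 hξ] with x h1 h2
    exact mul_nonneg h1 h2
  have h2 := hnn (V - F) (sub_nonneg.2 h1)
  rw [inner_sub_left] at h2
  exact ⟨hnn F h0, sub_nonneg.1 h2⟩

theorem Lp_nonneg_of_inner_nonneg [SigmaFinite μ] {F : Lp ℝ 2 μ}
    (h : ∀ ξ : Lp ℝ 2 μ, 0 ≤ ξ → 0 ≤ (inner ℝ F ξ : ℝ)) : 0 ≤ F := by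
  rw [← Lp.coeFn_nonneg]
  refine ae_nonneg_of_forall_setIntegral_nonneg_of_sigmaFinite ?_ ?_
  · intro s hs hμ
    exact (L2.integrable_inner (𝕜 := ℝ) (indicatorConstLp 2 hs hμ.ne (1 : ℝ)) F |>.congr (by
      filter_upwards [indicatorConstLp_coeFn (p := 2) (hs := hs) (hμs := hμ.ne) (c := (1 : ℝ))]
        with x hx
      rw [hx]
      by_cases hxs : x ∈ s <;> simp [hxs]) |> fun h : Integrable (s.indicator F) μ =>
        (integrable_indicator_iff hs).1 h)
  · intro s hs hμ
    have h1 := h (indicatorConstLp 2 hs hμ.ne (1 : ℝ)) (by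
      rw [← Lp.coeFn_nonneg]
      filter_upwards [indicatorConstLp_coeFn (p := 2) (hs := hs) (hμs := hμ.ne) (c := (1 : ℝ))]
        with x hx
      rw [hx]
      exact Set.indicator_nonneg (fun _ _ => zero_le_one) x)
    rwa [real_inner_comm, L2.inner_indicatorConstLp_one] at h1

/-- Riesz representation: the functional found by minimax is an actual function between `0` and `V`.
-/
theorem exists_eq_toDual_of_mem_orderIntervalDual [SigmaFinite μ] {V : Lp ℝ 2 μ}
    {T : WeakDual ℝ (Lp ℝ 2 μ)} (hT : T ∈ orderIntervalDual V) :
    ∃ F : Lp ℝ 2 μ, 0 ≤ F ∧ F ≤ V ∧ ∀ ξ, T ξ = inner ℝ F ξ := by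
  have hrep : ∀ ξ, T ξ =
      inner ℝ ((InnerProductSpace.toDual ℝ (Lp ℝ 2 μ)).symm (WeakDual.toStrongDual T)) ξ := by
    intro ξ
    rw [InnerProductSpace.toDual_symm_apply]
    rfl
  refine ⟨_, Lp_nonneg_of_inner_nonneg fun ξ hξ => ?_, sub_nonneg.1
    (Lp_nonneg_of_inner_nonneg fun ξ hξ => ?_), hrep⟩
  · rw [← hrep]; exact (hT ξ hξ).1
  · rw [inner_sub_left, ← hrep]; exact sub_nonneg.2 (hT ξ hξ).2

end OrderInterval

/-! ### Minimax for densities bounded by `u` -/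

/-- An `L²` weight that is bounded below on compact sets, used to embed test functions in `L²`. -/
noncomputable def gaussWeight (p : ℝ × ℝ) : ℝ := Real.exp (-p.1 ^ 2) * Real.exp (-p.2 ^ 2)

theorem gaussWeight_pos (p : ℝ × ℝ) : 0 < gaussWeight p := by
  unfold gaussWeight; positivity

theorem continuous_gaussWeight : Continuous gaussWeight := by
  unfold gaussWeight; fun_prop

theorem memLp_gaussWeight : MemLp gaussWeight 2 := by
  rw [memLp_two_iff_integrable_sq continuous_gaussWeight.aestronglyMeasurable]
  have h : Integrable (fun x : ℝ => Real.exp (-2 * x ^ 2)) :=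
    integrable_exp_neg_mul_sq (by norm_num)
  refine (h.mul_prod h).congr (.of_forall fun p => ?_)
  simp only [gaussWeight, mul_pow, ← Real.exp_nat_mul]
  congr 2 <;> push_cast <;> ring

/-- A bilinear minimax principle on the set of densities `0 ≤ f ≤ u`, tested against continuous
compactly supported functions. -/
theorem exists_density_of_forall_test {u : ℝ × ℝ → ℝ} (hu_nonneg : ∀ᵐ p, 0 ≤ u p)
    (hu_bdd : MemLp u ⊤ volume) {Y : Set ((ℝ × ℝ → ℝ) × ℝ)} (hY : Convex ℝ Y)
    (hYc : ∀ y ∈ Y, Continuous y.1 ∧ HasCompactSupport y.1) {α : ℝ}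
    (hα : ∀ y ∈ Y, y.2 - ∫ p, max (-y.1 p) 0 * u p ≤ α) :
    ∃ f : ℝ × ℝ → ℝ, AEStronglyMeasurable f ∧ (∀ᵐ p, 0 ≤ f p) ∧ (∀ᵐ p, f p ≤ u p) ∧
      ∀ y ∈ Y, (∫ p, y.1 p * f p) + y.2 ≤ α := by
  -- With `w = gaussWeight`, the density `f` is encoded as `F = w f` and the test function as `ζ /
  -- w`. Both lie in `L²`, and their pairing is still `∫ ζ f`.
  have hVm : MemLp (fun p => gaussWeight p * u p) 2 := hu_bdd.mul memLp_gaussWeight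
  set V : Lp ℝ 2 (volume : Measure (ℝ × ℝ)) := hVm.toLp _ with hVdef
  have hV : V =ᵐ[volume] fun p => gaussWeight p * u p := hVm.coeFn_toLp
  have hemb : ∀ ζ : ℝ × ℝ → ℝ, Continuous ζ → HasCompactSupport ζ →
      MemLp (fun p => ζ p * (gaussWeight p)⁻¹) 2 := fun ζ hζ hζc =>
    (hζ.mul (continuous_gaussWeight.inv₀ fun p => (gaussWeight_pos p).ne')).memLp_of_hasCompactSupport
      hζc.mul_right
  let Z : Set (Lp ℝ 2 (volume : Measure (ℝ × ℝ)) × ℝ) :=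
    {z | ∃ y ∈ Y, z.1 =ᵐ[volume] (fun p => y.1 p * (gaussWeight p)⁻¹) ∧ z.2 = y.2}
  have hZ : Convex ℝ Z := by
    rintro z ⟨y, hy, hzy, hzy'⟩ w ⟨x, hx, hwx, hwx'⟩ a b ha hb hab
    refine ⟨a • y + b • x, hY hy hx ha hb hab, ?_, by simp [hzy', hwx']⟩
    have e : (a • z + b • w).1 = a • z.1 + b • w.1 := rfl
    rw [e]
    filter_upwards [Lp.coeFn_add (a • z.1) (b • w.1), Lp.coeFn_smul a z.1, Lp.coeFn_smul b w.1,
      hzy, hwx] with p h1 h2 h3 h4 h5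
    rw [h1, Pi.add_apply, h2, h3, Pi.smul_apply, Pi.smul_apply, h4, h5]
    simp; ring
  have hex : ∀ z ∈ Z, ∃ T ∈ orderIntervalDual V, T z.1 + z.2 ≤ α := by
    rintro z ⟨y, hy, hzy, hzy'⟩
    have hms : MeasurableSet {p | y.1 p < 0} :=
      measurableSet_lt (hYc y hy).1.measurable measurable_const
    -- For fixed `ζ`, the integral `∫ ζ f` is least for `f = u` on `{ζ < 0}` and `f = 0` elsewhere,
    -- with value `-∫ ζ⁻ u`.
    have hFm : MemLp ({p | y.1 p < 0}.indicator (fun p => gaussWeight p * u p)) 2 :=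
      hVm.indicator hms
    set F : Lp ℝ 2 (volume : Measure (ℝ × ℝ)) := hFm.toLp _
    have hF : F =ᵐ[volume] {p | y.1 p < 0}.indicator (fun p => gaussWeight p * u p) :=
      hFm.coeFn_toLp
    have hF0 : 0 ≤ F := by
      rw [← Lp.coeFn_nonneg]
      filter_upwards [hF, hu_nonneg] with p h1 h2
      rw [h1]
      exact Set.indicator_apply_nonneg fun _ => mul_nonneg (gaussWeight_pos _).le h2
    have hF1 : F ≤ V := by
      rw [← Lp.coeFn_le]
      filter_upwards [hF, hV, hu_nonneg] with p h1 h2 h3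
      rw [h1, h2]
      by_cases hp : p ∈ {p | y.1 p < 0}
      · rw [Set.indicator_of_mem hp]
      · rw [Set.indicator_of_notMem hp]
        exact mul_nonneg (gaussWeight_pos _).le h3
    refine ⟨_, toDual_mem_orderIntervalDual hF0 hF1, ?_⟩
    have e : StrongDual.toWeakDual (InnerProductSpace.toDual ℝ _ F) z.1 = inner ℝ F z.1 := rfl
    rw [e, inner_Lp_eq_integral, hzy']
    have e2 : ∫ p, F p * z.1 p = - ∫ p, max (-y.1 p) 0 * u p := by
      rw [← integral_neg]
      refine integral_congr_ae ?_
      filter_upwards [hF, hzy] with p h1 h2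
      rw [h1, h2]
      have hw := (gaussWeight_pos p).ne'
      by_cases hp : y.1 p < 0
      · rw [Set.indicator_of_mem (show p ∈ {p | y.1 p < 0} from hp), max_eq_left (by linarith)]
        field_simp
      · rw [Set.indicator_of_notMem (show p ∉ {p | y.1 p < 0} from hp), max_eq_right (by linarith)]
        simp
    rw [e2]
    linarith [hα y hy]
  have hV0 : 0 ≤ V := by
    rw [← Lp.coeFn_nonneg]
    filter_upwards [hV, hu_nonneg] with p h1 h2
    rw [h1]
    exact mul_nonneg (gaussWeight_pos _).le h2
  obtain ⟨T, hT, hTα⟩ := exists_forall_apply_add_le (isCompact_orderIntervalDual V)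
    (convex_orderIntervalDual V) ⟨_, toDual_mem_orderIntervalDual hV0 le_rfl⟩ hZ hex
  obtain ⟨F, hF0, hF1, hTF⟩ := exists_eq_toDual_of_mem_orderIntervalDual hT
  refine ⟨fun p => F p * (gaussWeight p)⁻¹, ?_, ?_, ?_, ?_⟩
  · exact (Lp.aestronglyMeasurable F).mul
      (continuous_gaussWeight.inv₀ fun p => (gaussWeight_pos p).ne').aestronglyMeasurable
  · filter_upwards [(Lp.coeFn_nonneg F).2 hF0] with p h1
    exact mul_nonneg h1 (inv_nonneg.2 (gaussWeight_pos _).le)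
  · filter_upwards [(Lp.coeFn_le F V).2 hF1, hV] with p h1 h2
    rw [h2] at h1
    rw [← div_eq_mul_inv, div_le_iff₀ (gaussWeight_pos p)]
    linarith
  · intro y hy
    have hm := hemb y.1 (hYc y hy).1 (hYc y hy).2
    have := hTα (hm.toLp _, y.2) ⟨y, hy, hm.coeFn_toLp, rfl⟩
    simp only [hTF, inner_Lp_eq_integral] at this
    refine le_trans (le_of_eq ?_) this
    congr 1
    refine integral_congr_ae ?_
    filter_upwards [hm.coeFn_toLp] with p h1
    rw [h1]
    ring

/-! ### Recovering marginals and cost from test functions -/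

open Topology Filter Set in
/-- A nonnegative lower semicontinuous function on a locally compact second countable metric space
is the increasing limit of continuous functions with compact support. -/
theorem LowerSemicontinuous.exists_monotone_hasCompactSupport_iSup_eq {X : Type*} [MetricSpace X]
    [LocallyCompactSpace X] [SecondCountableTopology X] {c : X → ENNReal}
    (hc : LowerSemicontinuous c) :
    ∃ ζ : ℕ → X → ℝ, Monotone ζ ∧ (∀ n, Continuous (ζ n)) ∧ (∀ n, HasCompactSupport (ζ n)) ∧
      (∀ n x, 0 ≤ ζ n x) ∧ (∀ x, ⨆ n, ENNReal.ofReal (ζ n x) = c x) := by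
  let S : Set (X → ℝ) := {ζ | Continuous ζ ∧ HasCompactSupport ζ ∧ (∀ x, 0 ≤ ζ x) ∧
    ∀ x, ENNReal.ofReal (ζ x) ≤ c x}
  let G : Set (X → ENNReal) := (fun ζ x => ENNReal.ofReal (ζ x)) '' S
  have hG : ∀ f ∈ G, LowerSemicontinuous f := by
    rintro _ ⟨ζ, hζ, rfl⟩
    exact (ENNReal.continuous_ofReal.comp hζ.1).lowerSemicontinuous
  have hlub : IsLUB G c := by
    constructor
    · rintro _ ⟨ζ, hζ, rfl⟩ x
      exact hζ.2.2.2 x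
    · intro b hb x
      refine le_of_forall_lt fun t ht => ?_
      obtain ⟨s, hts, hs⟩ := exists_between ht
      have hs_top : s ≠ ⊤ := (lt_of_lt_of_le hs le_top).ne
      have hopen : IsOpen {y | s < c y} := hc.isOpen_preimage s
      -- A Urysohn bump supported where `c > s`, scaled by `s`, stays below `c` and attains `s` at
      -- `x`.
      obtain ⟨ζ, h1, h0, hcs, hζ⟩ := exists_continuous_one_zero_of_isCompact
        (isCompact_singleton (x := x)) hopen.isClosed_compl (by simpa using hs)
      have hmem : (fun y => s.toReal * ζ y) ∈ S := by
        refine ⟨continuous_const.mul ζ.continuous, hcs.mul_left,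
          fun y => mul_nonneg ENNReal.toReal_nonneg (hζ y).1, fun y => ?_⟩
        by_cases hy : s < c y
        · refine le_trans (ENNReal.ofReal_le_of_le_toReal ?_) hy.le
          exact mul_le_of_le_one_right ENNReal.toReal_nonneg (hζ y).2
        · have : ζ y = 0 := h0 hy
          simp [this]
      have := hb ⟨_, hmem, rfl⟩ x
      have h1x : ζ x = 1 := h1 rfl
      simp only [h1x, mul_one, ENNReal.ofReal_toReal hs_top] at this
      exact lt_of_lt_of_le hts this
  obtain ⟨G', hG'sub, hG'c, hG'⟩ := exists_countable_lowerSemicontinuous_isLUB hG hlub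
  have hlubx : ∀ x, IsLUB ((fun f : X → ENNReal => f x) '' G') (c x) := fun x => isLUB_pi.1 hG' x
  obtain ⟨S', hS'sub, hS'c, hS'⟩ : ∃ S' ⊆ S, S'.Countable ∧
      ∀ x, IsLUB ((fun ζ : X → ℝ => ENNReal.ofReal (ζ x)) '' S') (c x) := by
    choose! r hr hr' using hG'sub
    refine ⟨r '' G', by rintro _ ⟨f, hf, rfl⟩; exact hr hf, hG'c.image r, fun x => ?_⟩
    convert hlubx x using 1
    rw [image_image]
    exact image_congr fun f hf => congrFun (hr' hf) x
  -- Inserting `0` makes the countable family nonempty, so that it can be enumerated. Partial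
  -- suprema then make the sequence monotone without leaving `S`.
  have h0S : (0 : X → ℝ) ∈ S :=
    ⟨continuous_const, HasCompactSupport.zero, fun _ => le_rfl, fun _ => by simp⟩
  obtain ⟨e, he⟩ := (hS'c.insert (0 : X → ℝ)).exists_eq_range (insert_nonempty _ _)
  have heS : ∀ n, e n ∈ S := fun n => by
    have : e n ∈ insert (0 : X → ℝ) S' := he ▸ mem_range_self n
    rcases this with h | h
    · rw [h]; exact h0S
    · exact hS'sub h
  have hpS : ∀ n, partialSups e n ∈ S := by
    intro n
    induction n with
    | zero => simpa using heS 0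
    | succ n ih =>
      rw [← Order.succ_eq_add_one, partialSups_succ, Order.succ_eq_add_one]
      obtain ⟨a1, a2, a3, a4⟩ := ih
      obtain ⟨b1, b2, b3, b4⟩ := heS (n + 1)
      refine ⟨a1.sup b1, ?_, fun x => le_sup_of_le_left (a3 x), fun x => ?_⟩
      · refine HasCompactSupport.intro (a2.isCompact.union b2.isCompact) fun x hx => ?_
        rw [mem_union, not_or] at hx
        simp [image_eq_zero_of_notMem_tsupport hx.1, image_eq_zero_of_notMem_tsupport hx.2]
      · rcases le_total (partialSups e n x) (e (n + 1) x) with h | h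
        · simpa [sup_of_le_right h] using b4 x
        · simpa [sup_of_le_left h] using a4 x
  refine ⟨partialSups e, (partialSups e).monotone, fun n => (hpS n).1, fun n => (hpS n).2.1,
    fun n => (hpS n).2.2.1, fun x => le_antisymm (iSup_le fun n => (hpS n).2.2.2 x) ?_⟩
  refine (hS' x).2 ?_
  rintro _ ⟨ζ, hζ, rfl⟩
  obtain ⟨n, hn⟩ : ζ ∈ range e := he ▸ mem_insert_of_mem _ hζ
  refine le_trans (ENNReal.ofReal_le_ofReal ?_)
    (le_iSup (fun n => ENNReal.ofReal (partialSups e n x)) n)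
  rw [← hn]
  exact le_partialSups e n x

theorem ae_integral_eq_of_forall_integral_fst_mul {f : ℝ × ℝ → ℝ} {g : ℝ → ℝ} (hf : Integrable f)
    (hg : Integrable g)
    (h : ∀ a : ℝ → ℝ, Continuous a → (∃ M, ∀ x, |a x| ≤ M) →
      ∫ p, a p.1 * f p = ∫ x, a x * g x) :
    ∀ᵐ x, ∫ y, f (x, y) = g x := by
  refine ae_eq_of_integral_contDiff_smul_eq (hf.integral_prod_left).locallyIntegrable
    hg.locallyIntegrable fun a ha hac => ?_
  obtain ⟨M, hM⟩ := hac.exists_bound_of_continuous ha.continuous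
  have hint : Integrable (fun p : ℝ × ℝ => a p.1 * f p) :=
    hf.bdd_mul (c := M) (ha.continuous.comp continuous_fst).aestronglyMeasurable
      (.of_forall fun p => hM p.1)
  have h1 := h a ha.continuous ⟨M, hM⟩
  rw [Measure.volume_eq_prod, integral_prod _ hint] at h1
  simp only [smul_eq_mul, ← h1, integral_const_mul]

theorem lintegral_mul_ofReal_le_of_forall_test {c : ℝ × ℝ → ENNReal} (hc : LowerSemicontinuous c)
    {f : ℝ × ℝ → ℝ} (hf : MemLp f ⊤ volume) (hf0 : ∀ᵐ p, 0 ≤ f p) {A : ℝ}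
    (h : ∀ ζ : ℝ × ℝ → ℝ, Continuous ζ → HasCompactSupport ζ →
      (∀ p, ENNReal.ofReal (ζ p) ≤ c p) → ∫ p, ζ p * f p ≤ A) :
    ∫⁻ p, c p * ENNReal.ofReal (f p) ≤ ENNReal.ofReal A := by
  obtain ⟨ζ, hmono, hcont, hcs, h0, hsup⟩ := hc.exists_monotone_hasCompactSupport_iSup_eq
  have hfm : AEMeasurable (fun p => ENNReal.ofReal (f p)) :=
    hf.aestronglyMeasurable.aemeasurable.ennreal_ofReal
  have e : ∀ p, c p * ENNReal.ofReal (f p) =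
      ⨆ n, ENNReal.ofReal (ζ n p) * ENNReal.ofReal (f p) := fun p => by
    rw [← ENNReal.iSup_mul, hsup]
  simp_rw [e]
  rw [lintegral_iSup' (f := fun n p => ENNReal.ofReal (ζ n p) * ENNReal.ofReal (f p))
    (fun n => (hcont n).measurable.ennreal_ofReal.aemeasurable.mul hfm)
    (.of_forall fun p m n hmn => by
      dsimp only; gcongr; exact hmono hmn p)]
  refine iSup_le fun n => ?_
  have hle : ∀ p, ENNReal.ofReal (ζ n p) ≤ c p := fun p => by
    rw [← hsup]; exact le_iSup (fun n => ENNReal.ofReal (ζ n p)) n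
  have hint : Integrable (fun p => ζ n p * f p) :=
    ((hcont n).integrable_of_hasCompactSupport (hcs n)).mul_of_top_left hf
  calc ∫⁻ p, ENNReal.ofReal (ζ n p) * ENNReal.ofReal (f p)
      = ∫⁻ p, ENNReal.ofReal (ζ n p * f p) := by
        simp_rw [ENNReal.ofReal_mul (h0 n _)]
    _ = ENNReal.ofReal (∫ p, ζ n p * f p) := by
        rw [ofReal_integral_eq_lintegral_ofReal hint]
        filter_upwards [hf0] with p hp using mul_nonneg (h0 n p) hp
    _ ≤ ENNReal.ofReal A := ENNReal.ofReal_le_ofReal (h _ (hcont n) (hcs n) hle)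

/-! ### Construction of an optimal coupling for a nonnegative cost -/

/-- The tent functions `x ↦ min 1 (n + 1 - |x|)⁺`, an exhaustion of the constant `1`. -/
noncomputable def tent (n : ℕ) (x : ℝ) : ℝ := max 0 (min 1 (n + 1 - |x|))

theorem continuous_tent (n : ℕ) : Continuous (tent n) := by
  unfold tent; fun_prop

theorem tent_nonneg (n : ℕ) (x : ℝ) : 0 ≤ tent n x := le_max_left _ _

theorem tent_le_one (n : ℕ) (x : ℝ) : tent n x ≤ 1 :=
  max_le zero_le_one (min_le_left _ _)

theorem abs_tent_le_one (n : ℕ) (x : ℝ) : |tent n x| ≤ 1 := by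
  rw [abs_of_nonneg (tent_nonneg n x)]; exact tent_le_one n x

theorem tent_eq_zero {n : ℕ} {x : ℝ} (h : x ∉ Set.Icc (-(n + 1 : ℝ)) (n + 1)) : tent n x = 0 := by
  refine max_eq_left (min_le_of_right_le ?_)
  rw [Set.mem_Icc, ← abs_le] at h
  linarith

theorem tendsto_integral_tent_mul {g : ℝ → ℝ} (hg : Integrable g) :
    Filter.Tendsto (fun n => ∫ x, tent n x * g x) Filter.atTop (nhds (∫ x, g x)) := by
  refine tendsto_integral_of_dominated_convergence (fun x => |g x|)
    (fun n => (continuous_tent n).aestronglyMeasurable.mul hg.aestronglyMeasurable) hg.abs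
    (fun n => .of_forall fun x => ?_) (.of_forall fun x => ?_)
  · rw [Real.norm_eq_abs, abs_mul]
    exact mul_le_of_le_one_left (abs_nonneg _) (abs_tent_le_one n x)
  · refine tendsto_const_nhds.congr' ?_
    filter_upwards [Filter.eventually_ge_atTop ⌈|x|⌉₊] with n hn
    have : |x| ≤ n := (Nat.le_ceil _).trans (by exact_mod_cast hn)
    have h1 : tent n x = 1 := by
      unfold tent
      rw [min_eq_left (by linarith), max_eq_right zero_le_one]
    rw [h1, one_mul]

/-- The constraint set of the dual problem: pairs of a test function `ζ` and the value
`∫ φ g + ∫ ψ h`, where `φ(x) + ψ(y) + ζ(x, y) ≤ c(x, y)`. -/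
def testPairs (c : ℝ × ℝ → ENNReal) (g h : ℝ → ℝ) : Set ((ℝ × ℝ → ℝ) × ℝ) :=
  {y | Continuous y.1 ∧ HasCompactSupport y.1 ∧ ∃ φ ψ : ℝ → ℝ, Continuous φ ∧ Continuous ψ ∧
    (∃ M, ∀ x, |φ x| ≤ M) ∧ (∃ M, ∀ x, |ψ x| ≤ M) ∧
    (∀ p : ℝ × ℝ, ENNReal.ofReal (φ p.1 + ψ p.2 + y.1 p) ≤ c p) ∧
    y.2 = (∫ x, φ x * g x) + ∫ x, ψ x * h x}

theorem exists_abs_add_smul_le {φ φ' : ℝ → ℝ} (h : ∃ M, ∀ x, |φ x| ≤ M)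
    (h' : ∃ M, ∀ x, |φ' x| ≤ M) (a b : ℝ) : ∃ M, ∀ x, |a * φ x + b * φ' x| ≤ M := by
  obtain ⟨M, hM⟩ := h
  obtain ⟨M', hM'⟩ := h'
  refine ⟨|a| * M + |b| * M', fun x => (abs_add_le _ _).trans ?_⟩
  rw [abs_mul, abs_mul]
  gcongr
  exacts [hM x, hM' x]

theorem MeasureTheory.Integrable.continuous_bdd_mul {g φ : ℝ → ℝ} (hg : Integrable g)
    (hφ : Continuous φ) (h : ∃ M, ∀ x, |φ x| ≤ M) : Integrable (fun x => φ x * g x) := by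
  obtain ⟨M, hM⟩ := h
  exact hg.bdd_mul (c := M) hφ.aestronglyMeasurable (.of_forall hM)

theorem convex_testPairs {c : ℝ × ℝ → ENNReal} {g h : ℝ → ℝ} (hg : Integrable g)
    (hh : Integrable h) : Convex ℝ (testPairs c g h) := by
  rintro y ⟨yc, ys, φ, ψ, hφ, hψ, hφb, hψb, hle, hy⟩ y' ⟨yc', ys', φ', ψ', hφ', hψ', hφb', hψb',
    hle', hy'⟩ a b ha hb hab
  refine ⟨(yc.const_smul a).add (yc'.const_smul b), ys.smul_left.add ys'.smul_left,
    fun x => a * φ x + b * φ' x, fun x => a * ψ x + b * ψ' x, by fun_prop, by fun_prop,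
    exists_abs_add_smul_le hφb hφb' a b, exists_abs_add_smul_le hψb hψb' a b, fun p => ?_, ?_⟩
  · have e : a * φ p.1 + b * φ' p.1 + (a * ψ p.2 + b * ψ' p.2) + (a • y + b • y').1 p =
        a * (φ p.1 + ψ p.2 + y.1 p) + b * (φ' p.1 + ψ' p.2 + y'.1 p) := by
      simp; ring
    dsimp only
    rw [e]
    calc _ ≤ ENNReal.ofReal (a * (φ p.1 + ψ p.2 + y.1 p)) +
          ENNReal.ofReal (b * (φ' p.1 + ψ' p.2 + y'.1 p)) := ENNReal.ofReal_add_le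
      _ ≤ ENNReal.ofReal a * c p + ENNReal.ofReal b * c p := by
          rw [ENNReal.ofReal_mul ha, ENNReal.ofReal_mul hb]
          gcongr
          exacts [hle p, hle' p]
      _ = c p := by rw [← add_mul, ← ENNReal.ofReal_add ha hb, hab, ENNReal.ofReal_one, one_mul]
  · have e : ∀ {g φ φ' : ℝ → ℝ}, Integrable g → Continuous φ → Continuous φ' →
        (∃ M, ∀ x, |φ x| ≤ M) → (∃ M, ∀ x, |φ' x| ≤ M) →
        ∫ x, (a * φ x + b * φ' x) * g x = a * (∫ x, φ x * g x) + b * ∫ x, φ' x * g x := by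
      intro g φ φ' hg hφ hφ' hb hb'
      rw [← integral_const_mul, ← integral_const_mul, ← integral_add
        ((hg.continuous_bdd_mul hφ hb).const_mul a) ((hg.continuous_bdd_mul hφ' hb').const_mul b)]
      congr 1 with x
      ring
    rw [e hg hφ hφ' hφb hφb', e hh hψ hψ' hψb hψb']
    simp only [Prod.snd_add, Prod.smul_snd, smul_eq_mul, hy, hy']
    ring

/-- If the dual objective is at most `α` on all triples of bounded continuous functions, then there
is a feasible density whose cost is at most `α`. -/
theorem exists_coupling_of_forall_dual_le {g h : ℝ → ℝ} {u : ℝ × ℝ → ℝ} {c : ℝ × ℝ → ENNReal}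
    (hc : LowerSemicontinuous c)
    (hg_int : Integrable g) (hg_one : ∫ x, g x = 1) (hh_int : Integrable h) (hh_one : ∫ y, h y = 1)
    (hu_nonneg : ∀ᵐ p, 0 ≤ u p) (hu_bdd : MemLp u ⊤ volume) {α : ℝ}
    (hα : ∀ (φ ψ : ℝ → ℝ) (κ : ℝ × ℝ → ℝ), Continuous φ → Continuous ψ → Continuous κ →
      (∃ M, ∀ x, |φ x| ≤ M) → (∃ M, ∀ x, |ψ x| ≤ M) → HasCompactSupport κ → (∀ p, 0 ≤ κ p) →
      (∀ p : ℝ × ℝ, ENNReal.ofReal (φ p.1 + ψ p.2 - κ p) ≤ c p) →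
      dualObjective g h u (φ, ψ, κ) ≤ α) :
    ∃ f, IsCapacityCoupling g h u f ∧ ∫⁻ p, c p * ENNReal.ofReal (f p) ≤ ENNReal.ofReal α := by
  obtain ⟨f, hfm, hf0, hfu, hf⟩ := exists_density_of_forall_test hu_nonneg hu_bdd
    (convex_testPairs (c := c) hg_int hh_int) (fun y hy => ⟨hy.1, hy.2.1⟩) (α := α) (by
      rintro y ⟨yc, ys, φ, ψ, hφ, hψ, hφb, hψb, hle, hy⟩
      -- With `κ = ζ⁻` one has `-κ ≤ ζ`, so `(φ, ψ, κ)` inherits feasibility from `(φ, ψ, ζ)`.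
      have := hα φ ψ (fun p => max (-y.1 p) 0) hφ hψ (by fun_prop) hφb hψb
        (ys.comp_left (g := fun t => max (-t) 0) (by simp)) (fun p => le_max_right _ _)
        (fun p => (ENNReal.ofReal_le_ofReal (by linarith [le_max_left (-y.1 p) 0])).trans (hle p))
      rw [hy]
      exact this)
  have hftop : MemLp f ⊤ volume := hu_bdd.mono hfm (by
    filter_upwards [hf0, hfu] with p h1 h2
    rw [Real.norm_eq_abs, Real.norm_eq_abs, abs_of_nonneg h1]
    exact h2.trans (le_abs_self _))
  -- Since `c ≥ 0`, all multiples `n (φ, ψ, ζ)` are feasible. Their values are bounded by `α`, so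
  -- the value of the triple itself cannot be positive.
  have hcone : ∀ (φ ψ : ℝ → ℝ) (ζ : ℝ × ℝ → ℝ), Continuous φ → Continuous ψ → Continuous ζ →
      (∃ M, ∀ x, |φ x| ≤ M) → (∃ M, ∀ x, |ψ x| ≤ M) → HasCompactSupport ζ →
      (∀ p : ℝ × ℝ, φ p.1 + ψ p.2 + ζ p ≤ 0) →
      (∫ p, ζ p * f p) + ((∫ x, φ x * g x) + ∫ x, ψ x * h x) ≤ 0 := by
    intro φ ψ ζ hφ hψ hζ hφb hψb hζs hle
    have hn : ∀ n : ℕ, n * ((∫ p, ζ p * f p) + ((∫ x, φ x * g x) + ∫ x, ψ x * h x)) ≤ α := by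
      intro n
      have := hf ((n : ℝ) • ζ, n * ((∫ x, φ x * g x) + ∫ x, ψ x * h x))
        ⟨hζ.const_smul (n : ℝ), hζs.smul_left, fun x => n * φ x, fun x => n * ψ x, by fun_prop,
          by fun_prop, by simpa using exists_abs_add_smul_le hφb hφb n 0,
          by simpa using exists_abs_add_smul_le hψb hψb n 0, fun p => ?_, ?_⟩
      · simp only [Pi.smul_apply, smul_eq_mul, mul_assoc, integral_const_mul] at this
        linarith
      · rw [ENNReal.ofReal_of_nonpos]
        · exact bot_le
        · have := mul_nonpos_of_nonneg_of_nonpos (Nat.cast_nonneg (α := ℝ) n) (hle p)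
          simp only [Pi.smul_apply, smul_eq_mul]
          linarith
      · simp only [mul_assoc, integral_const_mul]
        ring
    by_contra! hpos
    obtain ⟨n, hn'⟩ := exists_nat_gt (α / ((∫ p, ζ p * f p) +
      ((∫ x, φ x * g x) + ∫ x, ψ x * h x)))
    rw [div_lt_iff₀ hpos] at hn'
    exact absurd (hn n) (not_le.2 hn')
  -- Apply `hcone` to `(-a, -b, ζ)` with `ζ ≤ a + b` compactly supported, then let `ζ` increase to
  -- `a + b`.
  have hlin : ∀ a b : ℝ → ℝ, Continuous a → Continuous b → (∃ M, ∀ x, |a x| ≤ M) →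
      (∃ M, ∀ x, |b x| ≤ M) → (∀ x, 0 ≤ a x) → (∀ x, 0 ≤ b x) →
      ∫⁻ p, ENNReal.ofReal (a p.1 + b p.2) * ENNReal.ofReal (f p) ≤
        ENNReal.ofReal ((∫ x, a x * g x) + ∫ x, b x * h x) := by
    intro a b ha hb hab hbb ha0 hb0
    refine lintegral_mul_ofReal_le_of_forall_test (c := fun p => ENNReal.ofReal (a p.1 + b p.2))
      (ENNReal.continuous_ofReal.comp (by fun_prop)).lowerSemicontinuous hftop hf0
      fun ζ hζ hζs hle => ?_
    have := hcone (fun x => -a x) (fun x => -b x) ζ ha.neg hb.neg hζ (by simpa using hab)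
      (by simpa using hbb) hζs (fun p => by
        have := (ENNReal.ofReal_le_ofReal_iff (add_nonneg (ha0 p.1) (hb0 p.2))).1 (hle p)
        linarith)
    simp only [neg_mul, integral_neg] at this
    linarith
  have hint : Integrable f := by
    refine ⟨hfm, ?_⟩
    rw [hasFiniteIntegral_iff_ofReal hf0]
    have := hlin (fun _ => 1) (fun _ => 0) continuous_const continuous_const ⟨1, by simp⟩
      ⟨0, by simp⟩ (by simp) (by simp)
    simp only [add_zero, ENNReal.ofReal_one, one_mul] at this
    exact this.trans_lt ENNReal.ofReal_lt_top
  have hfint : ∀ a b : ℝ → ℝ, Continuous a → Continuous b → (∃ M, ∀ x, |a x| ≤ M) →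
      (∃ M, ∀ x, |b x| ≤ M) → Integrable (fun p : ℝ × ℝ => (a p.1 + b p.2) * f p) := by
    rintro a b ha hb ⟨M, hM⟩ ⟨M', hM'⟩
    refine hint.bdd_mul (c := M + M') (by fun_prop) (.of_forall fun p => ?_)
    exact (norm_add_le _ _).trans (add_le_add (hM _) (hM' _))
  have hlin' : ∀ a b : ℝ → ℝ, Continuous a → Continuous b → (∃ M, ∀ x, |a x| ≤ M) →
      (∃ M, ∀ x, |b x| ≤ M) → (∀ x, 0 ≤ a x) → (∀ x, 0 ≤ b x) →
      0 ≤ (∫ x, a x * g x) + (∫ x, b x * h x) →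
      ∫ p : ℝ × ℝ, (a p.1 + b p.2) * f p ≤ (∫ x, a x * g x) + ∫ x, b x * h x := by
    intro a b ha hb hab hbb ha0 hb0 h0
    have h1 := hlin a b ha hb hab hbb ha0 hb0
    simp_rw [← ENNReal.ofReal_mul (add_nonneg (ha0 _) (hb0 _))] at h1
    rwa [← ofReal_integral_eq_lintegral_ofReal (hfint a b ha hb hab hbb) (by
      filter_upwards [hf0] with p hp using mul_nonneg (add_nonneg (ha0 _) (hb0 _)) hp),
      ENNReal.ofReal_le_ofReal_iff h0] at h1
  have hmass : ∫ p, f p = 1 := by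
    refine le_antisymm ?_ ?_
    · have := hlin' (fun _ => 1) (fun _ => 0) continuous_const continuous_const ⟨1, by simp⟩
        ⟨0, by simp⟩ (by simp) (by simp) (by simp [hg_one])
      simpa [hg_one] using this
    · have hlim := ((tendsto_integral_tent_mul hg_int).add (tendsto_integral_tent_mul hh_int)).sub
        (tendsto_const_nhds (x := (1 : ℝ)))
      rw [hg_one, hh_one, add_sub_cancel_right] at hlim
      refine le_of_tendsto hlim (.of_forall fun n => ?_)
      -- With `s`, `t` the two tent values, `s + (t - 1) - s t = -(1 - s)(1 - t) ≤ 0`. In the limit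
      -- this bounds the mass of `f` below by `1 + 1 - 1`.
      have := hcone (tent n) (fun x => tent n x + -1) (fun p => -(tent n p.1 * tent n p.2))
        (continuous_tent n) ((continuous_tent n).add continuous_const)
        (((continuous_tent n).comp continuous_fst).mul ((continuous_tent n).comp continuous_snd)).neg
        ⟨1, abs_tent_le_one n⟩ ⟨1, fun x => by
          rw [abs_le]; constructor <;> linarith [tent_nonneg n x, tent_le_one n x]⟩
        (HasCompactSupport.intro ((isCompact_Icc (a := -(n + 1 : ℝ)) (b := n + 1)).prod
          (isCompact_Icc (a := -(n + 1 : ℝ)) (b := n + 1))) fun p hp => by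
          rw [Set.mem_prod, not_and_or] at hp
          rcases hp with hp | hp <;> simp [tent_eq_zero hp])
        (fun p => by nlinarith [tent_le_one n p.1, tent_le_one n p.2])
      have e : ∫ x, (tent n x + -1) * h x = (∫ x, tent n x * h x) - 1 := by
        simp_rw [add_mul]
        rw [integral_add (hh_int.continuous_bdd_mul (continuous_tent n) ⟨1, abs_tent_le_one n⟩)
          (hh_int.const_mul _), integral_const_mul, hh_one]
        ring
      rw [e] at this
      have hle : ∫ p : ℝ × ℝ, tent n p.1 * tent n p.2 * f p ≤ ∫ p, f p := by
        refine integral_mono_of_nonneg ?_ hint ?_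
        · filter_upwards [hf0] with p hp
          exact mul_nonneg (mul_nonneg (tent_nonneg _ _) (tent_nonneg _ _)) hp
        · filter_upwards [hf0] with p hp
          exact mul_le_of_le_one_left hp
            (mul_le_one₀ (tent_le_one _ _) (tent_nonneg _ _) (tent_le_one _ _))
      simp only [neg_mul, integral_neg] at this
      linarith
  have hle : ∀ a b : ℝ → ℝ, Continuous a → Continuous b → (∃ M, ∀ x, |a x| ≤ M) →
      (∃ M, ∀ x, |b x| ≤ M) →
      ∫ p : ℝ × ℝ, (a p.1 + b p.2) * f p ≤ (∫ x, a x * g x) + ∫ x, b x * h x := by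
    rintro a b ha hb ⟨M, hM⟩ ⟨M', hM'⟩
    have shift : ∀ {g a : ℝ → ℝ} (M : ℝ), Integrable g → ∫ x, g x = 1 → Continuous a →
        (∃ M, ∀ x, |a x| ≤ M) → ∫ x, (a x + M) * g x = (∫ x, a x * g x) + M := by
      intro g a M hg hg1 ha hab
      simp_rw [add_mul]
      rw [integral_add (hg.continuous_bdd_mul ha hab) (hg.const_mul M), integral_const_mul, hg1,
        mul_one]
    have bound : ∀ {a : ℝ → ℝ} {M : ℝ}, (∀ x, |a x| ≤ M) → ∃ N, ∀ x, |a x + M| ≤ N :=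
      fun {a M} hM => ⟨M + |M|, fun x => (abs_add_le _ _).trans (by gcongr; exact hM x)⟩
    have hnn : ∀ {a : ℝ → ℝ} {M : ℝ}, (∀ x, |a x| ≤ M) → ∀ x, 0 ≤ a x + M :=
      fun {a M} hM x => by linarith [(abs_le.1 (hM x)).1]
    set I := ∫ x, a x * g x
    set J := ∫ x, b x * h x
    -- Adding `M` and `M'` makes `a` and `b` nonnegative; adding `|I|` and `|J|` also makes the
    -- right-hand side nonnegative, as `hlin'` demands. The constants cancel because `f`, `g` and
    -- `h` all have mass one.
    have hM₁ : ∀ x, |a x| ≤ M + |I| := fun x => (hM x).trans (le_add_of_nonneg_right (abs_nonneg I))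
    have hM₂ : ∀ x, |b x| ≤ M' + |J| :=
      fun x => (hM' x).trans (le_add_of_nonneg_right (abs_nonneg J))
    have hMn := (abs_nonneg _).trans (hM 0)
    have hMn' := (abs_nonneg _).trans (hM' 0)
    have e₁ := shift (M + |I|) hg_int hg_one ha ⟨M, hM⟩
    have e₂ := shift (M' + |J|) hh_int hh_one hb ⟨M', hM'⟩
    have := hlin' (fun x => a x + (M + |I|)) (fun x => b x + (M' + |J|)) (by fun_prop)
      (by fun_prop) (bound hM₁) (bound hM₂) (hnn hM₁) (hnn hM₂) (by
        rw [e₁, e₂]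
        linarith [neg_abs_le I, neg_abs_le J])
    rw [e₁, e₂] at this
    have e₃ : ∫ p : ℝ × ℝ, (a p.1 + (M + |I|) + (b p.2 + (M' + |J|))) * f p =
        (∫ p : ℝ × ℝ, (a p.1 + b p.2) * f p) + (M + |I| + (M' + |J|)) := by
      rw [← mul_one (M + |I| + (M' + |J|)), ← hmass, ← integral_const_mul, ← integral_add
        (hfint a b ha hb ⟨M, hM⟩ ⟨M', hM'⟩) (hint.const_mul _)]
      congr 1 with p
      ring
    rw [e₃] at this
    linarith
  have heq : ∀ a b : ℝ → ℝ, Continuous a → Continuous b → (∃ M, ∀ x, |a x| ≤ M) →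
      (∃ M, ∀ x, |b x| ≤ M) →
      ∫ p : ℝ × ℝ, (a p.1 + b p.2) * f p = (∫ x, a x * g x) + ∫ x, b x * h x := by
    intro a b ha hb hab hbb
    -- The inequality is linear in `(a, b)`, so its instance at `(-a, -b)` is the reverse one.
    refine le_antisymm (hle a b ha hb hab hbb) ?_
    have := hle (fun x => -a x) (fun x => -b x) ha.neg hb.neg (by simpa using hab)
      (by simpa using hbb)
    simp only [← neg_add, neg_mul, integral_neg] at this
    linarith
  have hcost : ∫⁻ p, c p * ENNReal.ofReal (f p) ≤ ENNReal.ofReal α := by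
    refine lintegral_mul_ofReal_le_of_forall_test hc hftop hf0 fun ζ hζ hζs hle => ?_
    have := hf (ζ, 0) ⟨hζ, hζs, fun _ => 0, fun _ => 0, continuous_const, continuous_const,
      ⟨0, by simp⟩, ⟨0, by simp⟩, by simpa using hle, by simp⟩
    simpa using this
  refine ⟨f, ⟨hint, hf0, hfu, ?_, ?_⟩, hcost⟩
  · refine ae_integral_eq_of_forall_integral_fst_mul hint hg_int fun a ha hab => ?_
    simpa using heq a (fun _ => 0) ha continuous_const hab ⟨0, by simp⟩
  · refine ae_integral_eq_of_forall_integral_fst_mul (f := fun p => f p.swap) hint.swap hh_int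
      fun a ha hab => ?_
    have := heq (fun _ => 0) a continuous_const ha ⟨0, by simp⟩ hab
    simp only [zero_add, zero_mul, integral_zero] at this
    rw [← this, Measure.volume_eq_prod, ← integral_prod_swap]
    rfl

/-! ### Weak duality for a nonnegative cost -/

theorem ae_eq_zero_of_marginal_eq_zero {f : ℝ × ℝ → ℝ} {g : ℝ → ℝ} (hf : Integrable f)
    (hf0 : ∀ᵐ p, 0 ≤ f p) (hg : AEStronglyMeasurable g) (hfg : ∀ᵐ x, ∫ y, f (x, y) = g x) :
    ∀ᵐ p : ℝ × ℝ, g p.1 = 0 → f p = 0 := by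
  obtain ⟨f', hf'm, hff'⟩ := hf.aestronglyMeasurable
  obtain ⟨g', hg'm, hgg'⟩ := hg
  have hm : MeasurableSet {p : ℝ × ℝ | g' p.1 = 0 → f' p = 0} :=
    ((hg'm.measurable.comp measurable_fst) (measurableSet_singleton 0)).imp
      (hf'm.measurable (measurableSet_singleton 0))
  have hfst : ∀ᵐ p : ℝ × ℝ, g p.1 = g' p.1 := Measure.quasiMeasurePreserving_fst.ae hgg'
  suffices h : ∀ᵐ p : ℝ × ℝ, g' p.1 = 0 → f' p = 0 by
    filter_upwards [h, hff', hfst] with p h1 h2 h3 h4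
    rw [h2]
    exact h1 (h3 ▸ h4)
  rw [Measure.volume_eq_prod] at hf0 hff' ⊢
  refine (Measure.ae_prod_iff_ae_ae hm).2 ?_
  filter_upwards [hf.prod_right_ae, Measure.ae_ae_of_ae_prod hf0, hfg, hgg',
    Measure.ae_ae_of_ae_prod hff'] with x h1 h2 h3 h4 h5
  rw [← h4, ← h3]
  by_cases h0 : ∫ y, f (x, y) = 0
  · filter_upwards [(integral_eq_zero_iff_of_nonneg_ae h2 h1).1 h0, h5] with y h6 h7 _
    rw [← h7, h6]
    rfl
  · exact .of_forall fun y h => absurd h h0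

/-- Integrability of `a g` says nothing about `a`, not even measurability, where `g = 0`. There `a`
is replaced by `0` (the value of `a g / g`), which is harmless because `f` vanishes almost
everywhere over `{g = 0}`. Fubini then applies. -/
theorem integrable_fst_mul_of_marginal {f : ℝ × ℝ → ℝ} {g a : ℝ → ℝ} (hf : Integrable f)
    (hf0 : ∀ᵐ p, 0 ≤ f p) (hg : AEStronglyMeasurable g) (hfg : ∀ᵐ x, ∫ y, f (x, y) = g x)
    (ha : Integrable (fun x => a x * g x)) :
    Integrable (fun p : ℝ × ℝ => a p.1 * f p) ∧ ∫ p : ℝ × ℝ, a p.1 * f p = ∫ x, a x * g x := by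
  set b : ℝ → ℝ := fun x => a x * g x / g x with hb
  have hbm : AEStronglyMeasurable b := (ha.1.aemeasurable.div hg.aemeasurable).aestronglyMeasurable
  have hbg : ∀ x, b x * g x = a x * g x := fun x => by
    by_cases h : g x = 0
    · simp [h]
    · simp only [hb]; field_simp
  have hae : (fun p : ℝ × ℝ => b p.1 * f p) =ᵐ[volume] fun p => a p.1 * f p := by
    filter_upwards [ae_eq_zero_of_marginal_eq_zero hf hf0 hg hfg] with p hp
    by_cases h : g p.1 = 0
    · simp [hp h]
    · simp only [hb]; field_simp
  have hint : Integrable (fun p : ℝ × ℝ => b p.1 * f p) := by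
    have hm : AEStronglyMeasurable (fun p : ℝ × ℝ => b p.1 * f p) :=
      hbm.comp_fst.mul hf.1
    rw [Measure.volume_eq_prod] at hm ⊢
    refine (integrable_prod_iff hm).2 ⟨?_, ?_⟩
    · filter_upwards [hf.prod_right_ae] with x hx using hx.const_mul _
    · refine ha.norm.congr ?_
      rw [Measure.volume_eq_prod] at hf0
      filter_upwards [hfg, Measure.ae_ae_of_ae_prod hf0] with x h1 h2
      have e : ∫ y, ‖b x * f (x, y)‖ = ∫ y, ‖b x‖ * f (x, y) := by
        refine integral_congr_ae ?_
        filter_upwards [h2] with y hy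
        rw [norm_mul, Real.norm_of_nonneg hy]
      rw [e, integral_const_mul, ← hbg, norm_mul, ← h1,
        Real.norm_of_nonneg (integral_nonneg_of_ae h2)]
  refine ⟨hint.congr hae, ?_⟩
  rw [← integral_congr_ae hae]
  rw [Measure.volume_eq_prod] at hint ⊢
  rw [integral_prod _ hint]
  refine integral_congr_ae ?_
  filter_upwards [hfg] with x hx
  rw [integral_const_mul, hx, hbg]

namespace IsCapacityCoupling

variable {g h : ℝ → ℝ} {u f : ℝ × ℝ → ℝ}

theorem integrable_fst_mul (hf : IsCapacityCoupling g h u f) (hg : Integrable g) {a : ℝ → ℝ}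
    (ha : Integrable (fun x => a x * g x)) :
    Integrable (fun p : ℝ × ℝ => a p.1 * f p) ∧ ∫ p : ℝ × ℝ, a p.1 * f p = ∫ x, a x * g x :=
  integrable_fst_mul_of_marginal hf.integrable hf.nonneg hg.1 hf.marginal_fst ha

theorem integrable_snd_mul (hf : IsCapacityCoupling g h u f) (hh : Integrable h) {b : ℝ → ℝ}
    (hb : Integrable (fun y => b y * h y)) :
    Integrable (fun p : ℝ × ℝ => b p.2 * f p) ∧ ∫ p : ℝ × ℝ, b p.2 * f p = ∫ y, b y * h y := by
  obtain ⟨h1, h2⟩ := integrable_fst_mul_of_marginal (f := fun p => f p.swap) hf.integrable.swap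
    (Measure.measurePreserving_swap.quasiMeasurePreserving.ae hf.nonneg) hh.1 hf.marginal_snd hb
  refine ⟨h1.swap, ?_⟩
  rw [← h2, Measure.volume_eq_prod, ← integral_prod_swap]
  rfl

theorem integral_eq_one (hf : IsCapacityCoupling g h u f) (hg : ∫ x, g x = 1) :
    ∫ p, f p = 1 := by
  rw [← hg, Measure.volume_eq_prod, integral_prod _ hf.integrable]
  exact integral_congr_ae hf.marginal_fst

/-- Write `κ f = (f / u) (κ u)` with `0 ≤ f / u ≤ 1`; where `u = 0`, also `f = 0`. -/
theorem integrable_mul_of_integrable_mul_upper (hf : IsCapacityCoupling g h u f)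
    (hu : AEStronglyMeasurable u) {κ : ℝ × ℝ → ℝ} (hκ : Integrable (fun p => κ p * u p)) :
    Integrable (fun p => κ p * f p) := by
  have h1 : Integrable (fun p => f p / u p * (κ p * u p)) := by
    refine hκ.bdd_mul (c := 1)
      (hf.integrable.1.aemeasurable.div hu.aemeasurable).aestronglyMeasurable ?_
    filter_upwards [hf.nonneg, hf.le_upper] with p h1 h2
    rw [Real.norm_of_nonneg (div_nonneg h1 (h1.trans h2))]
    exact div_le_one_of_le₀ h2 (h1.trans h2)
  refine h1.congr ?_
  filter_upwards [hf.nonneg, hf.le_upper] with p h1 h2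
  by_cases h : u p = 0
  · have : f p = 0 := le_antisymm (h ▸ h2) h1
    simp [this]
  · field_simp

/-- The marginals turn `∫ φg + ∫ ψh` into an integral against `f`, and `κ ≥ 0` with `f ≤ u` gives
`-∫ κu ≤ -∫ κf`. Almost everywhere constraints suffice because the coupling has a density. -/
theorem dualObjective_le (hf : IsCapacityCoupling g h u f) (hg : Integrable g) (hh : Integrable h)
    (hu : AEStronglyMeasurable u) {c : ℝ × ℝ → ENNReal}
    {t : (ℝ → ℝ) × (ℝ → ℝ) × (ℝ × ℝ → ℝ)} (ht : t ∈ integrableTriples g h u)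
    (hle : ∀ᵐ p : ℝ × ℝ, ENNReal.ofReal (t.1 p.1 + t.2.1 p.2 - t.2.2 p) ≤ c p ∧ 0 ≤ t.2.2 p) :
    ENNReal.ofReal (dualObjective g h u t) ≤ ∫⁻ p, c p * ENNReal.ofReal (f p) := by
  obtain ⟨φ, ψ, κ⟩ := t
  obtain ⟨hφ, hψ, hκ⟩ := ht
  simp only at hφ hψ hκ hle
  obtain ⟨hφi, hφe⟩ := hf.integrable_fst_mul hg hφ
  obtain ⟨hψi, hψe⟩ := hf.integrable_snd_mul hh hψ
  have hκi := hf.integrable_mul_of_integrable_mul_upper hu hκ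
  have hκe : ∫ p, κ p * f p ≤ ∫ p, κ p * u p := by
    refine integral_mono_ae hκi hκ ?_
    filter_upwards [hf.le_upper, hle] with p h1 h2
    exact mul_le_mul_of_nonneg_left h1 h2.2
  calc ENNReal.ofReal (dualObjective g h u (φ, ψ, κ))
      ≤ ENNReal.ofReal (∫ p : ℝ × ℝ, (φ p.1 * f p + ψ p.2 * f p - κ p * f p)) := by
        refine ENNReal.ofReal_le_ofReal ?_
        rw [integral_sub (f := fun p : ℝ × ℝ => φ p.1 * f p + ψ p.2 * f p) (hφi.add hψi) hκi,
          integral_add hφi hψi, hφe, hψe]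
        simp only [dualObjective]
        linarith
    _ ≤ ENNReal.ofReal (∫ p : ℝ × ℝ, max (φ p.1 * f p + ψ p.2 * f p - κ p * f p) 0) := by
        refine ENNReal.ofReal_le_ofReal (integral_mono ((hφi.add hψi).sub hκi)
          ((hφi.add hψi).sub hκi).pos_part fun p => le_max_left _ _)
    _ = ∫⁻ p : ℝ × ℝ, ENNReal.ofReal (max (φ p.1 * f p + ψ p.2 * f p - κ p * f p) 0) :=
        ofReal_integral_eq_lintegral_ofReal ((hφi.add hψi).sub hκi).pos_part
          (.of_forall fun p => le_max_right _ _)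
    _ ≤ ∫⁻ p, c p * ENNReal.ofReal (f p) := by
        refine lintegral_mono_ae ?_
        filter_upwards [hle, hf.nonneg] with p h1 h2
        calc _ = ENNReal.ofReal (φ p.1 + ψ p.2 - κ p) * ENNReal.ofReal (f p) := by
              rw [← ENNReal.ofReal_mul' h2]
              rw [sub_mul, add_mul, ENNReal.ofReal_max, ENNReal.ofReal_zero]
              exact max_eq_left bot_le
            _ ≤ c p * ENNReal.ofReal (f p) := by gcongr; exact h1.1

end IsCapacityCoupling

/-! ### Reduction to a nonnegative cost -/

/-- The nonnegative cost `c(x, y) + K + C (|x| + |y|)`. -/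
noncomputable def shiftedCost (c : ℝ × ℝ → EReal) (C K : ℝ) (p : ℝ × ℝ) : ENNReal :=
  (c p + ((C * |p.1| + K + C * |p.2| : ℝ) : EReal)).toENNReal

theorem lowerSemicontinuous_shiftedCost {c : ℝ × ℝ → EReal} (hc : LowerSemicontinuous c)
    (C K : ℝ) : LowerSemicontinuous (shiftedCost c C K) := by
  have hℓ : Continuous (fun p : ℝ × ℝ => ((C * |p.1| + K + C * |p.2| : ℝ) : EReal)) :=
    continuous_coe_real_ereal.comp (by fun_prop)
  have h : LowerSemicontinuous
      (fun p : ℝ × ℝ => c p + ((C * |p.1| + K + C * |p.2| : ℝ) : EReal)) :=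
    hc.add' hℓ.lowerSemicontinuous fun p =>
      EReal.continuousAt_add (Or.inr (EReal.coe_ne_bot _)) (Or.inr (EReal.coe_ne_top _))
  exact EReal.continuous_toENNReal.comp_lowerSemicontinuous h
    fun _ _ hxy => EReal.toENNReal_le_toENNReal hxy

/-- The identity `a⁺ + l = (a + l)⁺ + a⁻`, kept free of subtraction so that it can be integrated
against `f` when `a = ⊤` occurs. -/
theorem EReal.toENNReal_add_ofReal {a : EReal} {l : ℝ} (hl : 0 ≤ l) (ha : ((-l : ℝ) : EReal) ≤ a) :
    a.toENNReal + ENNReal.ofReal l = (a + (l : EReal)).toENNReal + (-a).toENNReal := by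
  induction a using EReal.rec with
  | bot => exact absurd ha (by simp)
  | top => simp
  | coe r =>
    have hr : -l ≤ r := by exact_mod_cast ha
    rw [← EReal.coe_add, ← EReal.coe_neg]
    simp only [EReal.real_coe_toENNReal]
    rcases le_total 0 r with h | h
    · rw [ENNReal.ofReal_of_nonpos (neg_nonpos.2 h), add_zero, ENNReal.ofReal_add h hl]
    · rw [ENNReal.ofReal_of_nonpos h, zero_add, ← ENNReal.ofReal_add (by linarith) (by linarith)]
      congr 1
      ring

theorem EReal.ofReal_le_toENNReal_add {a : EReal} {l s k : ℝ} (ha : ((-l : ℝ) : EReal) ≤ a)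
    (h : (s : EReal) ≤ a + (k : EReal)) :
    ENNReal.ofReal (s + l - k) ≤ (a + (l : EReal)).toENNReal := by
  induction a using EReal.rec with
  | bot => exact absurd ha (by simp)
  | top => simp
  | coe r =>
    have hr : s ≤ r + k := by exact_mod_cast h
    rw [← EReal.coe_add, EReal.real_coe_toENNReal]
    exact ENNReal.ofReal_le_ofReal (by linarith)

theorem EReal.le_add_of_ofReal_le_toENNReal_add {a : EReal} {l s k : ℝ}
    (ha : ((-l : ℝ) : EReal) ≤ a) (h : ENNReal.ofReal (s + l - k) ≤ (a + (l : EReal)).toENNReal) :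
    (s : EReal) ≤ a + (k : EReal) := by
  induction a using EReal.rec with
  | bot => exact absurd ha (by simp)
  | top => simp
  | coe r =>
    have hr : -l ≤ r := by exact_mod_cast ha
    rw [← EReal.coe_add, EReal.real_coe_toENNReal,
      ENNReal.ofReal_le_ofReal_iff (by linarith)] at h
    rw [← EReal.coe_add]
    exact_mod_cast (by linarith : s ≤ r + k)

theorem EReal.coe_sub_coe_eq_of_add_eq {P Q N : ENNReal} {b : ℝ} (hb : 0 ≤ b)
    (hN : N ≤ ENNReal.ofReal b) (h : P + ENNReal.ofReal b = Q + N) :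
    (P : EReal) - (N : EReal) = (Q : EReal) - (b : EReal) := by
  have hNt : N ≠ ⊤ := (hN.trans_lt ENNReal.ofReal_lt_top).ne
  lift N to NNReal using hNt
  by_cases hP : P = ⊤
  · have hQ : Q = ⊤ := by
      rw [hP, top_add] at h
      by_contra hQ
      exact ENNReal.add_ne_top.2 ⟨hQ, ENNReal.coe_ne_top⟩ h.symm
    rw [hP, hQ]
    simp only [EReal.coe_ennreal_top]
    rw [EReal.top_sub_coe]
    exact EReal.top_sub_coe _
  · have hQ : Q ≠ ⊤ := fun hQ => by
      rw [hQ, top_add] at h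
      exact ENNReal.add_ne_top.2 ⟨hP, ENNReal.ofReal_ne_top⟩ h
    lift P to NNReal using hP
    lift Q to NNReal using hQ
    have h' := congrArg ENNReal.toReal h
    rw [ENNReal.toReal_add ENNReal.coe_ne_top ENNReal.ofReal_ne_top,
      ENNReal.toReal_add ENNReal.coe_ne_top ENNReal.coe_ne_top, ENNReal.toReal_ofReal hb] at h'
    simp only [ENNReal.coe_toReal] at h'
    have e : (P : ℝ) - N = Q - b := by linarith
    rw [EReal.coe_nnreal_eq_coe_real, EReal.coe_nnreal_eq_coe_real, EReal.coe_nnreal_eq_coe_real,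
      ← EReal.coe_sub, ← EReal.coe_sub, e]

section Shift

variable {g h : ℝ → ℝ} {u f : ℝ × ℝ → ℝ} {c : ℝ × ℝ → EReal} {C K : ℝ}

theorem dualObjective_add_shift (hg : Integrable g) (hg_one : ∫ x, g x = 1)
    (hg_mom : Integrable (fun x => |x| * g x)) (hh_mom : Integrable (fun y => |y| * h y))
    {φ ψ : ℝ → ℝ} {κ : ℝ × ℝ → ℝ} (hφ : Integrable (fun x => φ x * g x))
    (hψ : Integrable (fun y => ψ y * h y)) :
    dualObjective g h u (fun x => φ x + (C * |x| + K), fun y => ψ y + C * |y|, κ) =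
      dualObjective g h u (φ, ψ, κ) + (C * (∫ x, |x| * g x) + K + C * ∫ y, |y| * h y) := by
  have e1 : ∫ x, (φ x + (C * |x| + K)) * g x =
      (∫ x, φ x * g x) + (C * (∫ x, |x| * g x) + K) := by
    simp_rw [add_mul, mul_assoc]
    rw [integral_add (g := fun x => C * (|x| * g x) + K * g x) hφ
        ((hg_mom.const_mul C).add (hg.const_mul K)),
      integral_add (hg_mom.const_mul C) (hg.const_mul K), integral_const_mul, integral_const_mul,
      hg_one, mul_one]
  have e2 : ∫ y, (ψ y + C * |y|) * h y = (∫ y, ψ y * h y) + C * ∫ y, |y| * h y := by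
    simp_rw [add_mul, mul_assoc]
    rw [integral_add hψ (hh_mom.const_mul C), integral_const_mul]
  simp only [dualObjective, e1, e2]
  ring

/-- The subtracted constant is the integral of `C|x| + K + C|y|` against `f`, which depends only on
the marginals. Finite first moments make it finite, and it dominates the negative part of the cost.
-/
theorem primalCost_eq_sub (hc : LowerSemicontinuous c) (hC : 0 ≤ C) (hK : 0 ≤ K)
    (hc_lower : ∀ p : ℝ × ℝ, ((-(C * |p.1| + K + C * |p.2|) : ℝ) : EReal) ≤ c p)
    (hg : Integrable g) (hg_one : ∫ x, g x = 1)
    (hg_mom : Integrable (fun x => |x| * g x)) (hh : Integrable h)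
    (hh_mom : Integrable (fun y => |y| * h y)) (hf : IsCapacityCoupling g h u f) :
    primalCost c f = ((∫⁻ p, shiftedCost c C K p * ENNReal.ofReal (f p) : ENNReal) : EReal) -
      ((C * (∫ x, |x| * g x) + K + C * ∫ y, |y| * h y : ℝ) : EReal) := by
  have hℓ0 : ∀ p : ℝ × ℝ, 0 ≤ C * |p.1| + K + C * |p.2| := fun p => by positivity
  obtain ⟨h1i, h1e⟩ := hf.integrable_fst_mul hg hg_mom
  obtain ⟨h2i, h2e⟩ := hf.integrable_snd_mul hh hh_mom
  have hℓi : Integrable (fun p : ℝ × ℝ => (C * |p.1| + K + C * |p.2|) * f p) := by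
    refine (((h1i.const_mul C).add (hf.integrable.const_mul K)).add (h2i.const_mul C)).congr
      (.of_forall fun p => ?_)
    simp only [Pi.add_apply]
    ring
  have hℓe : ∫ p : ℝ × ℝ, (C * |p.1| + K + C * |p.2|) * f p =
      C * (∫ x, |x| * g x) + K + C * ∫ y, |y| * h y := by
    simp_rw [add_mul, mul_assoc]
    rw [integral_add (f := fun p : ℝ × ℝ => C * (|p.1| * f p) + K * f p)
      ((h1i.const_mul C).add (hf.integrable.const_mul K)) (h2i.const_mul C),
      integral_add (h1i.const_mul C) (hf.integrable.const_mul K), integral_const_mul,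
      integral_const_mul, integral_const_mul, h1e, h2e, hf.integral_eq_one hg_one, mul_one]
  have hℓn : ∀ᵐ p : ℝ × ℝ, 0 ≤ (C * |p.1| + K + C * |p.2|) * f p := by
    filter_upwards [hf.nonneg] with p hp using mul_nonneg (hℓ0 p) hp
  have hL : ∫⁻ p : ℝ × ℝ, ENNReal.ofReal (C * |p.1| + K + C * |p.2|) * ENNReal.ofReal (f p) =
      ENNReal.ofReal (C * (∫ x, |x| * g x) + K + C * ∫ y, |y| * h y) := by
    rw [← hℓe, ofReal_integral_eq_lintegral_ofReal hℓi hℓn]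
    simp_rw [ENNReal.ofReal_mul (hℓ0 _)]
  have hfm : AEMeasurable (fun p => ENNReal.ofReal (f p)) :=
    hf.integrable.1.aemeasurable.ennreal_ofReal
  refine EReal.coe_sub_coe_eq_of_add_eq ?_ ?_ ?_
  · rw [← hℓe]
    exact integral_nonneg_of_ae hℓn
  · rw [← hL]
    refine lintegral_mono fun p => ?_
    gcongr
    rw [← EReal.real_coe_toENNReal]
    exact EReal.toENNReal_le_toENNReal (EReal.neg_le.1 (by
      rw [← EReal.coe_neg]; exact hc_lower p))
  · rw [← hL, ← lintegral_add_right' _ (by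
      exact AEMeasurable.mul (by fun_prop) hfm), ← lintegral_add_right' _ (by
      exact AEMeasurable.mul (hc.measurable.neg.ereal_toENNReal.aemeasurable) hfm)]
    refine lintegral_congr fun p => ?_
    rw [← add_mul, ← add_mul, shiftedCost, EReal.toENNReal_add_ofReal (hℓ0 p) (hc_lower p)]

theorem EReal.coe_le_coe_sub_iff {Q : ENNReal} {s b : ℝ} :
    (s : EReal) ≤ (Q : EReal) - (b : EReal) ↔ ((s + b : ℝ) : EReal) ≤ (Q : EReal) := by
  rw [EReal.le_sub_iff_add_le (Or.inl (EReal.coe_ne_bot b)) (Or.inl (EReal.coe_ne_top b)),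
    EReal.coe_add]

theorem dualObjective_le_primalCost (hc : LowerSemicontinuous c) (hC : 0 ≤ C) (hK : 0 ≤ K)
    (hc_lower : ∀ p : ℝ × ℝ, ((-(C * |p.1| + K + C * |p.2|) : ℝ) : EReal) ≤ c p)
    (hg : Integrable g) (hg_one : ∫ x, g x = 1)
    (hg_mom : Integrable (fun x => |x| * g x)) (hh : Integrable h)
    (hh_mom : Integrable (fun y => |y| * h y)) (hu : AEStronglyMeasurable u)
    (hf : IsCapacityCoupling g h u f) {t : (ℝ → ℝ) × (ℝ → ℝ) × (ℝ × ℝ → ℝ)}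
    (ht : t ∈ dualSetAE c g h u) :
    (dualObjective g h u t : EReal) ≤ primalCost c f := by
  obtain ⟨φ, ψ, κ⟩ := t
  obtain ⟨⟨hφ, hψ, hκ⟩, hle⟩ := ht
  simp only at hφ hψ hκ hle
  rw [primalCost_eq_sub hc hC hK hc_lower hg hg_one hg_mom hh hh_mom hf,
    EReal.coe_le_coe_sub_iff, ← dualObjective_add_shift hg hg_one hg_mom hh_mom hφ hψ]
  have hφ' : Integrable (fun x => (φ x + (C * |x| + K)) * g x) := by
    refine (hφ.add ((hg_mom.const_mul C).add (hg.const_mul K))).congr (.of_forall fun x => ?_)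
    simp only [Pi.add_apply]
    ring
  have hψ' : Integrable (fun y => (ψ y + C * |y|) * h y) := by
    refine (hψ.add (hh_mom.const_mul C)).congr (.of_forall fun x => ?_)
    simp only [Pi.add_apply]
    ring
  have := hf.dualObjective_le hg hh hu (c := shiftedCost c C K)
    (t := (fun x => φ x + (C * |x| + K), fun y => ψ y + C * |y|, κ)) ⟨hφ', hψ', hκ⟩ (by
      filter_upwards [hle] with p hp
      refine ⟨?_, hp.2⟩
      refine le_trans (ENNReal.ofReal_le_ofReal (le_of_eq ?_))
        (EReal.ofReal_le_toENNReal_add (hc_lower p) hp.1)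
      ring)
  calc ((dualObjective g h u (fun x => φ x + (C * |x| + K), fun y => ψ y + C * |y|, κ) : ℝ) : EReal)
      ≤ ((ENNReal.ofReal (dualObjective g h u
          (fun x => φ x + (C * |x| + K), fun y => ψ y + C * |y|, κ)) : ENNReal) : EReal) := by
        rw [EReal.coe_ennreal_ofReal]
        exact_mod_cast le_max_left _ _
    _ ≤ _ := by exact_mod_cast this

/-- Subtracting `C|x| + K` from `φ` and `C|y|` from `ψ` turns bounded triples for the shifted cost
into elements of `continuousTriples C` feasible for `c`. -/
theorem exists_primalCost_le (hc : LowerSemicontinuous c) (hC : 0 ≤ C) (hK : 0 ≤ K)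
    (hc_lower : ∀ p : ℝ × ℝ, ((-(C * |p.1| + K + C * |p.2|) : ℝ) : EReal) ≤ c p)
    (hg : Integrable g) (hg_one : ∫ x, g x = 1)
    (hg_mom : Integrable (fun x => |x| * g x)) (hh : Integrable h) (hh_one : ∫ y, h y = 1)
    (hh_mom : Integrable (fun y => |y| * h y)) (hu_nonneg : ∀ᵐ p, 0 ≤ u p)
    (hu_bdd : MemLp u ⊤ volume) {α : ℝ}
    (hα : ∀ t ∈ dualSet c g h u ∩ continuousTriples C, dualObjective g h u t ≤ α) :
    ∃ f, IsCapacityCoupling g h u f ∧ primalCost c f ≤ (α : EReal) := by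
  set b : ℝ := C * (∫ x, |x| * g x) + K + C * ∫ y, |y| * h y with hb
  have key : ∀ (φ ψ : ℝ → ℝ) (κ : ℝ × ℝ → ℝ), Continuous φ → Continuous ψ → Continuous κ →
      (∃ M, ∀ x, |φ x| ≤ M) → (∃ M, ∀ x, |ψ x| ≤ M) → HasCompactSupport κ → (∀ p, 0 ≤ κ p) →
      (∀ p : ℝ × ℝ, ENNReal.ofReal (φ p.1 + ψ p.2 - κ p) ≤ shiftedCost c C K p) →
      dualObjective g h u (φ, ψ, κ) ≤ α + b := by
    intro φ ψ κ hφ hψ hκ hφb hψb hκs hκ0 hle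
    have hφi : Integrable (fun x => (φ x - (C * |x| + K)) * g x) := by
      refine ((hg.continuous_bdd_mul hφ hφb).sub
        ((hg_mom.const_mul C).add (hg.const_mul K))).congr (.of_forall fun x => ?_)
      simp only [Pi.add_apply, Pi.sub_apply]
      ring
    have hψi : Integrable (fun y => (ψ y - C * |y|) * h y) := by
      refine ((hh.continuous_bdd_mul hψ hψb).sub (hh_mom.const_mul C)).congr
        (.of_forall fun x => ?_)
      simp only [Pi.sub_apply]
      ring
    have hκi : Integrable (fun p => κ p * u p) :=
      (hκ.integrable_of_hasCompactSupport hκs).mul_of_top_left hu_bdd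
    have := dualObjective_add_shift (u := u) (κ := κ) (C := C) (K := K) hg hg_one hg_mom hh_mom
      hφi hψi
    simp only [sub_add_cancel] at this
    rw [this]
    gcongr
    refine hα _ ⟨⟨⟨hφi, hψi, hκi⟩, fun x y => ⟨?_, hκ0 _⟩⟩, ?_⟩
    · refine EReal.le_add_of_ofReal_le_toENNReal_add (hc_lower (x, y)) ?_
      refine le_trans (le_of_eq ?_) (hle (x, y))
      congr 1
      ring
    · obtain ⟨M₁, hM₁⟩ := hφb
      obtain ⟨M₂, hM₂⟩ := hψb
      obtain ⟨M₃, hM₃⟩ := hκs.exists_bound_of_continuous hκ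
      refine ⟨by fun_prop, by fun_prop, hκ, ⟨M₁ + K, fun x => ?_⟩, ⟨M₂, fun y => ?_⟩, M₃, hM₃⟩
      · have e : φ x - (C * |x| + K) + C * |x| = φ x - K := by ring
        dsimp only
        rw [e]
        refine (abs_sub _ _).trans ?_
        rw [abs_of_nonneg hK]
        gcongr
        exact hM₁ x
      · simpa using hM₂ y
  -- The zero triple is feasible for the shifted cost; hence `ENNReal.ofReal (α + b)` does not
  -- truncate.
  have h0 : 0 ≤ α + b := by
    simpa [dualObjective] using key 0 0 0 continuous_zero continuous_zero continuous_zero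
      ⟨0, by simp⟩ ⟨0, by simp⟩ HasCompactSupport.zero (by simp) (by simp)
  obtain ⟨f, hf, hcost⟩ := exists_coupling_of_forall_dual_le
    (lowerSemicontinuous_shiftedCost hc C K) hg hg_one hh hh_one hu_nonneg hu_bdd key
  refine ⟨f, hf, ?_⟩
  rw [primalCost_eq_sub hc hC hK hc_lower hg hg_one hg_mom hh hh_mom hf,
    EReal.sub_le_iff_le_add (Or.inl (EReal.coe_ne_bot _)) (Or.inl (EReal.coe_ne_top _)),
    ← EReal.coe_add, ← max_eq_left h0, ← EReal.coe_ennreal_ofReal]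
  exact_mod_cast hcost

theorem exists_primalCost_le_dualValue (hc : LowerSemicontinuous c) (hC : 0 ≤ C) (hK : 0 ≤ K)
    (hc_lower : ∀ p : ℝ × ℝ, ((-(C * |p.1| + K + C * |p.2|) : ℝ) : EReal) ≤ c p)
    (hg : Integrable g) (hg_one : ∫ x, g x = 1)
    (hg_mom : Integrable (fun x => |x| * g x)) (hh : Integrable h) (hh_one : ∫ y, h y = 1)
    (hh_mom : Integrable (fun y => |y| * h y)) (hu_nonneg : ∀ᵐ p, 0 ≤ u p)
    (hu_bdd : MemLp u ⊤ volume) (hne : ∃ f, IsCapacityCoupling g h u f) :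
    ∃ f, IsCapacityCoupling g h u f ∧
      primalCost c f ≤ dualValue g h u (dualSet c g h u ∩ continuousTriples C) := by
  have hle : ∀ t ∈ dualSet c g h u ∩ continuousTriples C, (dualObjective g h u t : EReal) ≤
      dualValue g h u (dualSet c g h u ∩ continuousTriples C) := fun t ht =>
    le_iSup₂ (f := fun t (_ : t ∈ dualSet c g h u ∩ continuousTriples C) =>
      (dualObjective g h u t : EReal)) t ht
  generalize dualValue g h u (dualSet c g h u ∩ continuousTriples C) = v at hle
  have hreal : ∀ α : ℝ, v ≤ α → ∃ f, IsCapacityCoupling g h u f ∧ primalCost c f ≤ (α : EReal) :=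
    fun α hv => exists_primalCost_le hc hC hK hc_lower hg hg_one hg_mom hh hh_one hh_mom hu_nonneg
      hu_bdd fun t ht => EReal.coe_le_coe_iff.1 ((hle t ht).trans hv)
  -- For the value `⊤` any coupling will do. The value `⊥` is impossible: it would give a coupling
  -- of cost at most `-b - 1`, while every coupling costs at least `-b`.
  induction v using EReal.rec with
  | top => exact hne.imp fun f hf => ⟨hf, le_top⟩
  | coe r => exact hreal r le_rfl
  | bot =>
    set b : ℝ := C * (∫ x, |x| * g x) + K + C * ∫ y, |y| * h y with hb
    obtain ⟨f, hf, hcost⟩ := hreal (-b - 1) bot_le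
    rw [primalCost_eq_sub hc hC hK hc_lower hg hg_one hg_mom hh hh_mom hf] at hcost
    have h1 := (EReal.coe_le_coe_sub_iff (s := -b) (b := b)).2 (by
      rw [neg_add_cancel]; exact EReal.coe_ennreal_nonneg _) |>.trans hcost
    exact absurd (EReal.coe_le_coe_iff.1 h1) (by linarith)

end Shift

/-! ### Strong duality -/

theorem lemma1 (g h : ℝ → ℝ) (u : ℝ × ℝ → ℝ) (c : ℝ × ℝ → EReal) (C : ℝ)
    -- `g` and `h` are bounded probability densities with finite first moments
    (hg_nonneg : ∀ᵐ x, 0 ≤ g x) (hg_bdd : MemLp g ⊤ volume)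
    (hg_int : Integrable g) (hg_one : ∫ x, g x = 1)
    (hg_mom : Integrable (fun x => |x| * g x))
    (hh_nonneg : ∀ᵐ y, 0 ≤ h y) (hh_bdd : MemLp h ⊤ volume)
    (hh_int : Integrable h) (hh_one : ∫ y, h y = 1)
    (hh_mom : Integrable (fun y => |y| * h y))
    -- the capacity bound
    (hu_nonneg : ∀ᵐ p, 0 ≤ u p) (hu_bdd : MemLp u ⊤ volume)
    -- the set of couplings is not empty
    (hne : ∃ f, IsCapacityCoupling g h u f)
    -- the cost is lower semicontinuous with linear lower growth
    (hc_lsc : LowerSemicontinuous c) (hC : 0 ≤ C)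
    (hc_lower : ∀ x y, ((-(C * (1 + |x| + |y|)) : ℝ) : EReal) ≤ c (x, y)) :
    -- strong duality
    primalValue c g h u = dualValue g h u (dualSet c g h u) ∧
    -- the same when the dual inequalities are required almost everywhere only
    primalValue c g h u = dualValue g h u (dualSetAE c g h u) ∧
    -- the infimum is attained
    (∃ f, IsCapacityCoupling g h u f ∧ primalCost c f = primalValue c g h u) ∧
    -- restriction to continuous functions that are bounded up to the growth of the cost
    dualValue g h u (dualSet c g h u ∩ continuousTriples C) = dualValue g h u (dualSet c g h u) ∧
    -- restriction to continuous bounded functions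
    ((∃ m : ℝ, ∀ p, (m : EReal) ≤ c p) →
      dualValue g h u (dualSet c g h u ∩ continuousTriples 0) =
        dualValue g h u (dualSet c g h u)) := by
  have hu := hu_bdd.aestronglyMeasurable
  -- The growth bound `C (1 + |x| + |y|)` is the shift with `K = C`.
  have hlow : ∀ p : ℝ × ℝ, ((-(C * |p.1| + C + C * |p.2|) : ℝ) : EReal) ≤ c p := fun p => by
    refine le_trans (le_of_eq ?_) (hc_lower p.1 p.2)
    congr 1
    ring
  have hsub : dualSet c g h u ⊆ dualSetAE c g h u :=
    fun t ht => ⟨ht.1, .of_forall fun p => ht.2 p.1 p.2⟩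
  have hmono : ∀ {S T : Set ((ℝ → ℝ) × (ℝ → ℝ) × (ℝ × ℝ → ℝ))}, S ⊆ T →
      dualValue g h u S ≤ dualValue g h u T := fun h => biSup_mono h
  have hweak : dualValue g h u (dualSetAE c g h u) ≤ primalValue c g h u :=
    iSup₂_le fun t ht => le_iInf₂ fun f hf => dualObjective_le_primalCost hc_lsc hC hC hlow hg_int
      hg_one hg_mom hh_int hh_mom hu hf ht
  have hprimal : ∀ f, IsCapacityCoupling g h u f → primalValue c g h u ≤ primalCost c f :=
    fun f hf => iInf₂_le f hf
  obtain ⟨f, hf, hcost⟩ := exists_primalCost_le_dualValue hc_lsc hC hC hlow hg_int hg_one hg_mom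
    hh_int hh_one hh_mom hu_nonneg hu_bdd hne
  have hcont := hmono (Set.inter_subset_left (s := dualSet c g h u) (t := continuousTriples C))
  -- Everything follows from one closed chain: primal value ≤ cost of `f` ≤ continuous dual ≤ dual ≤
  -- almost everywhere dual ≤ primal value.
  refine ⟨le_antisymm ((hprimal f hf).trans (hcost.trans hcont)) ((hmono hsub).trans hweak),
    le_antisymm ((hprimal f hf).trans (hcost.trans (hcont.trans (hmono hsub)))) hweak,
    ⟨f, hf, le_antisymm (hcost.trans (hcont.trans ((hmono hsub).trans hweak))) (hprimal f hf)⟩,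
    le_antisymm hcont (((hmono hsub).trans hweak).trans ((hprimal f hf).trans hcost)), ?_⟩
  rintro ⟨m, hm⟩
  -- A cost bounded below by `m` needs only the constant shift `m⁻`, so the argument runs with `C =
  -- 0` and the potentials remain bounded.
  obtain ⟨f', hf', hcost'⟩ := exists_primalCost_le_dualValue (C := 0) (K := max (-m) 0) hc_lsc le_rfl
    (le_max_right _ _) (fun p => le_trans (by
      have := le_max_left (-m) 0
      exact_mod_cast (by linarith : -(0 * |p.1| + max (-m) 0 + 0 * |p.2|) ≤ m)) (hm p))
    hg_int hg_one hg_mom hh_int hh_one hh_mom hu_nonneg hu_bdd hne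
  exact le_antisymm (hmono Set.inter_subset_left)
    (((hmono hsub).trans hweak).trans ((hprimal f' hf').trans hcost'))
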